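/- A Stirling permutation of order $k$ is a rearrangement of the multiset $\{1,1,2,2,\ldots,k,k\}$ in which, for each $i$, every entry between the two occurrences of $i$ is greater than $i$. The reduction of a word is obtained by replacing all occurrences of its $i$th smallest letter by $i$, for every $i$. A Stirling permutation of the second kind of order $n$ is a sequence of nonempty words (called cycles) $(c_1,c_2,\ldots,c_{2k})$ that together use exactly the entries of the multiset $\{1,1,2,2,\ldots,n,n\}$, such that: (i) for each $i\in[n]$ both copies of $i$ appear in the same cycle; (ii) each cycle begins with one of its smallest entries, and the cycles are listed in increasing order of their smallest entries; (iii) the reduction of the word $c_1c_2\cdots c_{2k}$ of each cycle is a Stirling permutation of order $k$. (For $n=0$ there is exactly one, the empty sequence.) It is a Stirling derangement if none of its cycles has the form $(k,k)$; let $\mathcal{DQ}_n$ be the set of Stirling derangements of order $n$. A cycle ascent plateau is an entry $c_i$ of a cycle $(c_1,\ldots,c_{2k})$ with $2\le i\le 2k-1$ and $c_{i-1}<c_i=c_{i+1}$; let $\mathrm{cap}(\sigma)$ be the number of cycle ascent plateaus in all cycles of $\sigma$. Put $$R_n(x)=\sum_{\sigma\in\mathcal{DQ}_n}x^{\mathrm{cap}(\sigma)},\qquad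 S(x,z)=\sum_{n\ge0}R_n(x)\frac{z^n}{n!}.$$ Let $\mathcal{D}_n$ be the set of permutations $\pi$ of $[n]$ without fixed points, let $\mathrm{exc}(\pi)=\#\{i:\pi(i)>i\}$, and put $$d_n(x)=\sum_{\pi\in\mathcal{D}_n}x^{\mathrm{exc}(\pi)},\qquad d(x,z)=\sum_{n\ge0}d_n(x)\frac{z^n}{n!}.$$ Then, as formal power series in $z$, $$S(x,z)=\sqrt{\frac{x-1}{xe^{2z}-e^{2xz}}},$$ where the quotient is taken in $\mathbb{Q}(x)[[z]]$ and the square root of a series with constant term $1$ is the one with constant term $1$; moreover $$S^2(x,z)=d(x,2z),$$ and, equivalently, for all $n\ge0$, $$2^nd_n(x)=\sum_{k=0}^n\binom{n}{k}R_k(x)R_{n-k}(x).$$ -/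

import Mathlib

open Polynomial

noncomputable section

namespace StirlingSecond

/-- The word `w` is a Stirling permutation of order `k`: a rearrangement of the multiset
`{1,1,2,2,…,k,k}` in which every entry between the two occurrences of `i` is greater than `i`
(`[i, j, i]` is a, not necessarily contiguous, subword exactly if some `j` lies between two
occurrences of `i`). -/
def IsStirlingPerm (k : ℕ) (w : List ℕ) : Prop :=
  (w : Multiset ℕ) = 2 • (Finset.Icc 1 k).val ∧
    ∀ i j : ℕ, List.Sublist [i, j, i] w → i < j

/-- The reduction of a word: all occurrences of its `i`-th smallest letter are replaced by `i`. -/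
def red (w : List ℕ) : List ℕ :=
  w.map fun a => (w.toFinset.filter (· ≤ a)).card

/-- `σ`, a list of cycles written as words, is (the standard cycle form of) a Stirling permutation
of the second kind of order `n`. For `n = 0` the only one is the empty list. -/
structure IsStirlingPermSecondKind (n : ℕ) (σ : List (List ℕ)) : Prop where
  /-- `σ` uses exactly the entries of the multiset `{1,1,2,2,…,n,n}`. -/
  entries : (σ.flatten : Multiset ℕ) = 2 • (Finset.Icc 1 n).val
  /-- Cycles are nonempty. -/
  cycle_ne_nil : ∀ c ∈ σ, c ≠ []
  /-- The two copies of each `i` appear in one and the same cycle. -/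
  copies : ∀ i ∈ Finset.Icc 1 n, ∃ c ∈ σ, c.count i = 2
  /-- Each cycle is written with one of its smallest entries first. -/
  head_le : ∀ c ∈ σ, ∀ a ∈ c, c.headI ≤ a
  /-- The cycles are written in increasing order of their smallest (i.e. first) entries. -/
  increasing : σ.Pairwise fun c c' => c.headI < c'.headI
  /-- The reduction of each cycle, read as a word of length `2k`, is a Stirling permutation of
  order `k`. -/
  stirling : ∀ c ∈ σ, ∃ k, c.length = 2 * k ∧ IsStirlingPerm k (red c)

/-- The entry `k` is a fixed point of `σ` if `(k k)` is a cycle of `σ`. -/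
def IsFixedPoint (σ : List (List ℕ)) (k : ℕ) : Prop := [k, k] ∈ σ

/-- Stirling derangements of order `n`: those without fixed points. -/
def IsStirlingDerangement (n : ℕ) (σ : List (List ℕ)) : Prop :=
  IsStirlingPermSecondKind n σ ∧ ∀ k ∈ Finset.Icc 1 n, ¬ IsFixedPoint σ k

/-- Number of ascent plateaus `c_{i-1} < c_i = c_{i+1}` (with `2 ≤ i ≤ m - 1`) of the word
`c_1 c_2 ⋯ c_m`. -/
def capCycle : List ℕ → ℕ
  | a :: b :: c :: l => (if a < b ∧ b = c then 1 else 0) + capCycle (b :: c :: l)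
  | _ => 0

/-- Number of cycle ascent plateaus of `σ`. -/
def cap (σ : List (List ℕ)) : ℕ := (σ.map capCycle).sum

theorem finite_lists {α : Type*} {s : Set α} (hs : s.Finite) (m : ℕ) :
    {l : List α | l.length ≤ m ∧ ∀ a ∈ l, a ∈ s}.Finite := by
  have := hs.to_subtype
  refine ((List.finite_length_le s m).image (List.map Subtype.val)).subset ?_
  rintro l ⟨hl, h⟩
  lift l to List s using h
  exact ⟨l, by simpa using hl, rfl⟩

theorem finite_stirlingDerangements (n : ℕ) : {σ | IsStirlingDerangement n σ}.Finite := by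
  refine (finite_lists (finite_lists (Finset.Icc 1 n).finite_toSet (2 * n)) (2 * n)).subset ?_
  rintro σ ⟨h, -⟩
  have hlen : (σ.map List.length).sum = 2 * n := by
    have := congrArg Multiset.card h.entries
    simpa [List.length_flatten] using this
  refine ⟨?_, fun c hc => ⟨?_, fun a ha => ?_⟩⟩
  · rw [← hlen]
    simpa using List.length_le_sum_of_one_le (σ.map List.length) (by
      intro i hi
      obtain ⟨c, hc, rfl⟩ := List.mem_map.1 hi
      exact List.length_pos_iff.2 (h.cycle_ne_nil c hc))
  · rw [← hlen]
    exact List.le_sum_of_mem (List.mem_map_of_mem hc)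
  · have h1 : a ∈ (σ.flatten : Multiset ℕ) := by
      simpa using ⟨c, hc, ha⟩
    rw [h.entries] at h1
    exact Multiset.mem_of_mem_nsmul h1

/-- The finite set of Stirling derangements of order `n`. -/
def stirlingDerangements (n : ℕ) : Finset (List (List ℕ)) :=
  (finite_stirlingDerangements n).toFinset

/-- The Stirling derangement polynomial `R_n(x)`. -/
def R (n : ℕ) : ℚ[X] := ∑ σ ∈ stirlingDerangements n, X ^ cap σ

/-- Number of excedances of a permutation. -/
def exc {n : ℕ} (π : Equiv.Perm (Fin n)) : ℕ := (Finset.univ.filter fun i => i < π i).card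

/-- The derangement polynomial `d_n(x)`. -/
def d (n : ℕ) : ℚ[X] := ∑ π ∈ (derangements (Fin n)).toFinite.toFinset, X ^ exc π

/-- The exponential generating function `∑ p_n(x) z^n / n!`, a formal power series in `z` over
`ℚ[x]`. -/
def egf (p : ℕ → ℚ[X]) : PowerSeries ℚ[X] :=
  PowerSeries.mk fun n => (n.factorial : ℚ)⁻¹ • p n

/-- The formal square root `√F = (1 + (F - 1))^{1/2} = ∑_k binom(1/2, k) (F - 1)^k` of a formal
power series `F` with constant term `1`. -/
def formalSqrt {K : Type*} [Field K] [Algebra ℚ K] (F : PowerSeries K) : PowerSeries K :=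
  (PowerSeries.binomialSeries K (1 / 2 : ℚ)).subst (F - 1)

/-- The series `e^{a z}`. -/
def expMul {K : Type*} [Field K] [Algebra ℚ K] (a : K) : PowerSeries K :=
  PowerSeries.rescale a (PowerSeries.exp K)

/-- `(x - 1) / (x e^{2z} - e^{2xz})`, a formal power series in `z` over the field `ℚ(x)` (the
denominator has the nonzero constant term `x - 1`). -/
def closedForm : PowerSeries (RatFunc ℚ) :=
  PowerSeries.C (RatFunc.X - 1) *
    (PowerSeries.C RatFunc.X * expMul 2 - expMul (2 * RatFunc.X))⁻¹

end StirlingSecond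

end

noncomputable section

namespace StirlingSecond

/-! Write F = x e^{2z} - e^{2xz} (`denom`). Both S² and d(x,2z) turn out to equal (x-1)/F. Over ℚ[x]
this is stated without division, as T * F = x - 1, and F is cancelled as a nonzero series.

For S, remove the cycle through the smallest letter. If it contains k further letters, they are
chosen in binom(n,k) ways, the cycle contributes g_k (`cyclePoly`), and a Stirling derangement of
the remaining letters is left; k = 0 is excluded, being a fixed point. With G the exponential
generating function of g, this says ∂S/∂z = (G - 1) S.

Cycles are built by inserting their largest letter as an adjacent pair. Counting how this changes
the ascent plateaus gives a recurrence for g_n, hence a first order linear PDE for G, with solution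
G = (x-1) e^{2xz} / F. Consequently G - 1 = x(e^{2xz} - e^{2z})/F is minus one half of the
logarithmic z-derivative of F, so S² F is constant in z, equal to its value x - 1 at z = 0.

For d, inserting the largest letter into a permutation gives the classical recurrence for the
excedance polynomials, and its PDE shows d(x,2z) F = x - 1. The square root formula follows because
a square root with constant term 1 is unique; the convolution identity is S² = d(x,2z) read
coefficientwise. -/

/-! ### Derivatives in x and z, exponential series and the denominator. -/

/-- Coefficientwise derivative `∂/∂x` of a power series over `ℚ[x]`. -/
def dX (P : PowerSeries ℚ[X]) : PowerSeries ℚ[X] :=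
  PowerSeries.mk fun n => derivative (PowerSeries.coeff n P)

@[simp] theorem coeff_dX (P : PowerSeries ℚ[X]) (n : ℕ) :
    PowerSeries.coeff n (dX P) = derivative (PowerSeries.coeff n P) := by
  simp [dX]

theorem dX_mul (P Q : PowerSeries ℚ[X]) : dX (P * Q) = dX P * Q + P * dX Q := by
  ext1 n
  simp only [coeff_dX, PowerSeries.coeff_mul, derivative_sum, derivative_mul, map_add,
    Finset.sum_add_distrib]

theorem dX_sub (P Q : PowerSeries ℚ[X]) : dX (P - Q) = dX P - dX Q := by
  ext1 n
  simp

theorem dX_C (p : ℚ[X]) : dX (PowerSeries.C p) = PowerSeries.C (derivative p) := by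
  ext1 n
  simp only [coeff_dX, PowerSeries.coeff_C]
  split_ifs <;> simp

/-- Formal derivative `∂/∂z`. -/
abbrev dZ (P : PowerSeries ℚ[X]) : PowerSeries ℚ[X] := PowerSeries.derivative ℚ[X] P

theorem dZ_mul (P Q : PowerSeries ℚ[X]) : dZ (P * Q) = dZ P * Q + P * dZ Q := by
  simp only [dZ, Derivation.leibniz, smul_eq_mul]; ring

theorem dZ_sub (P Q : PowerSeries ℚ[X]) : dZ (P - Q) = dZ P - dZ Q := map_sub _ _ _

theorem dZ_C (p : ℚ[X]) : dZ (PowerSeries.C p) = 0 := PowerSeries.derivative_C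

theorem coeff_zero_mul (P Q : PowerSeries ℚ[X]) : PowerSeries.coeff 0 (P * Q) =
    PowerSeries.coeff 0 P * PowerSeries.coeff 0 Q := by
  simp

/-- The series `e^{p z}` over `ℚ[x]`. -/
def polyExp (p : ℚ[X]) : PowerSeries ℚ[X] := PowerSeries.rescale p (PowerSeries.exp ℚ[X])

theorem coeff_polyExp (p : ℚ[X]) (n : ℕ) :
    PowerSeries.coeff n (polyExp p) = C ((n.factorial : ℚ)⁻¹) * p ^ n := by
  simp [polyExp, PowerSeries.coeff_rescale, PowerSeries.coeff_exp, mul_comm, Polynomial.algebraMap_eq]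

theorem natCast_succ_mul_inv_factorial (n : ℕ) :
    ((n : ℚ) + 1) * ((n + 1).factorial : ℚ)⁻¹ = (n.factorial : ℚ)⁻¹ := by
  have : (n.factorial : ℚ) ≠ 0 := by positivity
  rw [Nat.factorial_succ]
  push_cast
  field_simp

theorem C_inv_factorial_succ (n : ℕ) :
    (C ((n + 1).factorial : ℚ)⁻¹ : ℚ[X]) * ((n : ℚ[X]) + 1) = C ((n.factorial : ℚ)⁻¹) := by
  rw [← natCast_succ_mul_inv_factorial n]
  simp [mul_comm]

theorem dZ_polyExp (p : ℚ[X]) : dZ (polyExp p) = PowerSeries.C p * polyExp p := by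
  ext1 n
  rw [PowerSeries.coeff_derivative, PowerSeries.coeff_C_mul, coeff_polyExp, coeff_polyExp,
    ← C_inv_factorial_succ n]
  ring

theorem dX_polyExp (p : ℚ[X]) :
    dX (polyExp p) = PowerSeries.X * PowerSeries.C (derivative p) * polyExp p := by
  ext1 n
  rw [mul_assoc]
  cases n with
  | zero => simp [coeff_polyExp]
  | succ n =>
    rw [coeff_dX, PowerSeries.coeff_succ_X_mul, PowerSeries.coeff_C_mul, coeff_polyExp,
      coeff_polyExp, ← C_inv_factorial_succ n, derivative_C_mul, derivative_pow]
    push_cast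
    simp
    ring

/-- Uniqueness for the linear first order equations met below. -/
theorem eq_zero_of_pde {P : PowerSeries ℚ[X]} (a b c e : ℚ[X])
    (h : (1 - PowerSeries.C a * PowerSeries.X) * dZ P =
      PowerSeries.C b * dX P + PowerSeries.C c * P + PowerSeries.C e * (PowerSeries.X * P))
    (h0 : PowerSeries.coeff 0 P = 0) : P = 0 := by
  ext1 n
  rw [map_zero]
  induction n using Nat.strong_induction_on with
  | _ n ih =>
    cases n with
    | zero => exact h0
    | succ n =>
      -- In the coefficient of z^n the only new unknown is p_{n+1}, with factor n + 1; the other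
      -- terms involve p_k and p_k' with k ≤ n, which vanish by induction.
      have hn := congrArg (PowerSeries.coeff n) h
      rw [sub_mul, one_mul, mul_assoc] at hn
      have h1 : PowerSeries.coeff n (PowerSeries.X * dZ P) = 0 := by
        cases n with
        | zero => simp
        | succ k => rw [PowerSeries.coeff_succ_X_mul, PowerSeries.coeff_derivative,
            ih (k + 1) (by omega), zero_mul]
      have h2 : PowerSeries.coeff n (PowerSeries.X * P) = 0 := by
        cases n with
        | zero => simp
        | succ k => rw [PowerSeries.coeff_succ_X_mul, ih k (by omega)]
      simp only [map_sub, map_add, PowerSeries.coeff_C_mul, h1, h2, coeff_dX, ih n (by omega),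
        PowerSeries.coeff_derivative] at hn
      simp only [mul_zero, sub_zero, map_zero, add_zero] at hn
      rcases mul_eq_zero.1 hn with h | h
      · exact h
      · exact absurd h (by exact_mod_cast Nat.succ_ne_zero n)

/-- The denominator `x e^{2z} - e^{2xz}`. -/
def denom : PowerSeries ℚ[X] := PowerSeries.C X * polyExp 2 - polyExp (2 * X)

theorem coeff_zero_denom : PowerSeries.coeff 0 denom = X - 1 := by
  simp only [denom, map_sub, PowerSeries.coeff_C_mul, coeff_polyExp]
  simp

theorem denom_ne_zero : denom ≠ 0 := by
  intro h
  have := coeff_zero_denom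
  rw [h, map_zero] at this
  exact X_sub_C_ne_zero (1 : ℚ) (by simpa using this.symm)

theorem dZ_denom : dZ denom = PowerSeries.C (2 * X) * (polyExp 2 - polyExp (2 * X)) := by
  rw [denom, dZ_sub]
  rw [dZ_mul, dZ_polyExp, dZ_polyExp, dZ_C]
  simp only [map_mul]
  ring

theorem dX_denom :
    dX denom = polyExp 2 - PowerSeries.C 2 * PowerSeries.X * polyExp (2 * X) := by
  rw [denom, dX_sub, dX_mul, dX_polyExp, dX_polyExp, dX_C]
  simp only [derivative_mul, derivative_X, derivative_ofNat, map_zero, map_one, map_ofNat, zero_mul,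
    mul_zero, mul_one, one_mul, zero_add, add_zero]
  ring

/-! ### Exponential generating functions. -/

theorem coeff_egf (p : ℕ → ℚ[X]) (n : ℕ) :
    PowerSeries.coeff n (egf p) = C ((n.factorial : ℚ)⁻¹) * p n := by
  simp [egf, smul_eq_C_mul]

theorem dZ_egf (p : ℕ → ℚ[X]) : dZ (egf p) = egf fun n => p (n + 1) := by
  ext1 n
  rw [PowerSeries.coeff_derivative, coeff_egf, coeff_egf, ← C_inv_factorial_succ n]
  ring

theorem dX_egf (p : ℕ → ℚ[X]) : dX (egf p) = egf fun n => derivative (p n) := by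
  ext1 n
  rw [coeff_dX, coeff_egf, coeff_egf, derivative_C_mul]

theorem egf_add (p q : ℕ → ℚ[X]) : egf (fun n => p n + q n) = egf p + egf q := by
  ext1 n
  simp only [map_add, coeff_egf]; ring

theorem egf_const_mul (a : ℚ[X]) (p : ℕ → ℚ[X]) :
    egf (fun n => a * p n) = PowerSeries.C a * egf p := by
  ext1 n
  simp only [PowerSeries.coeff_C_mul, coeff_egf]; ring

theorem X_mul_egf (p : ℕ → ℚ[X]) :
    PowerSeries.X * egf p = egf fun n => (n : ℚ[X]) * p (n - 1) := by
  ext1 n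
  cases n with
  | zero => simp [coeff_egf]
  | succ n =>
    rw [PowerSeries.coeff_succ_X_mul, coeff_egf, coeff_egf, ← C_inv_factorial_succ n]
    push_cast
    ring

theorem egf_mul (p q : ℕ → ℚ[X]) :
    egf p * egf q =
      egf fun n => ∑ k ∈ Finset.range (n + 1), (n.choose k : ℚ[X]) * p k * q (n - k) := by
  ext1 n
  rw [PowerSeries.coeff_mul, coeff_egf, Finset.Nat.sum_antidiagonal_eq_sum_range_succ_mk,
    Finset.mul_sum]
  refine Finset.sum_congr rfl fun k hk => ?_
  have hk : k ≤ n := Nat.lt_succ_iff.1 (Finset.mem_range.1 hk)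
  have key : (C ((k.factorial : ℚ)⁻¹) * C (((n - k).factorial : ℚ)⁻¹) : ℚ[X]) =
      C ((n.factorial : ℚ)⁻¹) * (n.choose k : ℚ[X]) := by
    rw [← C_eq_natCast, ← C_mul, ← C_mul, Nat.cast_choose ℚ hk]
    congr 1
    have h1 : (k.factorial : ℚ) ≠ 0 := by positivity
    have h2 : ((n - k).factorial : ℚ) ≠ 0 := by positivity
    have h3 : (n.factorial : ℚ) ≠ 0 := by positivity
    field_simp
  simp only [coeff_egf]
  linear_combination (p k * q (n - k)) * key

/-! ### Recurrences turned into differential equations and closed forms. -/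

/-- The polynomials `g_n` enumerating single cycles on `n + 1` letters by ascent plateaus. -/
def cyclePoly : ℕ → ℚ[X]
  | 0 => 1
  | n + 1 => 2 * ((n : ℚ[X]) + 1) * X * cyclePoly n + 2 * X * (1 - X) * derivative (cyclePoly n)

theorem egf_cyclePoly_mul_denom :
    egf cyclePoly * denom = PowerSeries.C (X - 1) * polyExp (2 * X) := by
  have hG : dZ (egf cyclePoly) = PowerSeries.C (2 * X) * (PowerSeries.X * dZ (egf cyclePoly)) +
      PowerSeries.C (2 * X) * egf cyclePoly +
        PowerSeries.C (2 * X * (1 - X)) * dX (egf cyclePoly) := by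
    rw [dZ_egf, dX_egf, X_mul_egf, ← egf_const_mul, ← egf_const_mul, ← egf_const_mul, ← egf_add,
      ← egf_add]
    congr 1
    funext n
    cases n with
    | zero => simp [cyclePoly]
    | succ n => rw [cyclePoly]; push_cast; ring
  rw [← sub_eq_zero]
  -- The denominator solves the equation with the same a, b and with c = 2x, e = -4x; G solves it
  -- with c = 2x, e = 0. In a product the zeroth order terms add up, and (x-1) e^{2xz} solves the
  -- resulting equation too.
  refine eq_zero_of_pde (2 * X) (2 * X * (1 - X)) (4 * X) (- 4 * X) ?_ ?_
  · rw [dX_sub, dX_mul, dX_mul, dX_C, dX_polyExp, dX_denom, dZ_sub]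
    rw [dZ_mul, dZ_mul, dZ_denom, dZ_polyExp, dZ_C]
    simp only [map_mul, map_sub, map_one, derivative_mul, derivative_X,
      derivative_one, denom, map_neg, map_ofNat, derivative_ofNat, zero_mul, zero_add, mul_one,
      sub_zero] at hG ⊢
    linear_combination (PowerSeries.C X * polyExp 2 - polyExp (2 * X)) * hG
  · rw [map_sub, coeff_zero_mul, PowerSeries.coeff_C_mul, coeff_zero_denom, coeff_egf,
      coeff_polyExp]
    simp [cyclePoly]

/-- The polynomials enumerating derangements by excedances. -/
def derPoly : ℕ → ℚ[X]
  | 0 => 1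
  | 1 => 0
  | n + 2 => ((n : ℚ[X]) + 1) * X * derPoly (n + 1) + X * (1 - X) * derivative (derPoly (n + 1)) +
      ((n : ℚ[X]) + 1) * X * derPoly n

theorem rescale_egf (p : ℕ → ℚ[X]) :
    PowerSeries.rescale 2 (egf p) = egf fun n => 2 ^ n * p n := by
  ext1 n
  rw [PowerSeries.coeff_rescale, coeff_egf, coeff_egf]
  ring

theorem egf_derPoly_mul_denom :
    PowerSeries.rescale 2 (egf derPoly) * denom = PowerSeries.C (X - 1) := by
  rw [rescale_egf]
  set E := egf fun n => 2 ^ n * derPoly n with hE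
  have hG : dZ E = PowerSeries.C (2 * X) * (PowerSeries.X * dZ E) +
      PowerSeries.C (4 * X) * (PowerSeries.X * E) +
        PowerSeries.C (2 * X * (1 - X)) * dX E := by
    rw [hE, dZ_egf, dX_egf, X_mul_egf, X_mul_egf, ← egf_const_mul, ← egf_const_mul,
      ← egf_const_mul, ← egf_add, ← egf_add]
    congr 1
    funext n
    cases n with
    | zero => simp [derPoly]
    | succ n =>
      have h2 : derivative ((2 : ℚ[X]) ^ (n + 1)) = 0 := by
        rw [derivative_pow]; simp
      rw [derPoly, derivative_mul, h2]; push_cast; ring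
  rw [← sub_eq_zero]
  -- Here E has c = 0, e = 4x, so the z-terms of E and of the denominator cancel in the product; the
  -- constant x - 1 solves the remaining equation.
  refine eq_zero_of_pde (2 * X) (2 * X * (1 - X)) (2 * X) 0 ?_ ?_
  · rw [dX_sub, dX_mul, dX_C, dX_denom, dZ_sub]
    rw [dZ_mul, dZ_denom, dZ_C]
    simp only [map_mul, map_sub, map_one, derivative_X, map_zero, derivative_one, denom, map_ofNat,
      zero_mul, sub_zero] at hG ⊢
    linear_combination (PowerSeries.C X * polyExp 2 - polyExp (2 * X)) * hG
  · rw [map_sub, coeff_zero_mul, coeff_zero_denom, hE, coeff_egf]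
    simp [derPoly]

/-- The recurrence is the equation S' = (G - 1) S. As 2 (G - 1) F = -F', the z-derivative of S² F
vanishes. -/
theorem sq_egf_mul_denom {r : ℕ → ℚ[X]} (h0 : r 0 = 1)
    (h : ∀ n, r (n + 1) = ∑ k ∈ Finset.range (n + 1),
      (n.choose k : ℚ[X]) * (if k = 0 then 0 else cyclePoly k) * r (n - k)) :
    egf r ^ 2 * denom = PowerSeries.C (X - 1) := by
  have hS : dZ (egf r) = (egf cyclePoly - 1) * egf r := by
    have h1 : egf cyclePoly - 1 = egf fun k => if k = 0 then 0 else cyclePoly k := by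
      ext1 n
      rw [map_sub, coeff_egf, coeff_egf, PowerSeries.coeff_one]
      split_ifs with hn
      · subst hn; simp [cyclePoly]
      · simp
    rw [h1, egf_mul, dZ_egf]
    congr 1
    funext n
    exact h n
  have hd : dZ (egf r ^ 2 * denom - PowerSeries.C (X - 1)) = 0 := by
    have hGF := egf_cyclePoly_mul_denom
    have hF := dZ_denom
    rw [dZ_sub]
    rw [sq, dZ_mul, dZ_mul, hF, hS, dZ_C]
    simp only [denom, map_mul, map_ofNat, map_sub, map_one] at hGF ⊢
    linear_combination 2 * egf r ^ 2 * hGF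
  rw [← sub_eq_zero]
  refine eq_zero_of_pde 0 0 0 0 (by rw [hd]; simp) ?_
  rw [map_sub, coeff_zero_mul, coeff_zero_denom, sq, coeff_zero_mul,
    coeff_egf, h0]
  simp

/-! ### The formal square root and passage to ℚ(x). -/

/-- Exponents of binomial series add, so the square of the series for exponent 1/2 is 1 + X;
substituting F - 1 gives F. -/
theorem formalSqrt_sq {K : Type*} [Field K] [Algebra ℚ K] {F : PowerSeries K}
    (hF : PowerSeries.constantCoeff F = 1) : formalSqrt F ^ 2 = F := by
  have hs : PowerSeries.HasSubst (F - 1) :=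
    PowerSeries.HasSubst.of_constantCoeff_zero' (by simp [hF])
  rw [formalSqrt, sq, ← PowerSeries.subst_mul hs, ← PowerSeries.binomialSeries_add]
  norm_num
  have := PowerSeries.binomialSeries_nat (R := ℚ) (A := K) 1
  rw [Nat.cast_one] at this
  rw [this, pow_one, PowerSeries.subst_add hs, PowerSeries.subst_X hs]
  rw [← PowerSeries.coe_substAlgHom hs, map_one]
  ring

theorem constantCoeff_formalSqrt {K : Type*} [Field K] [Algebra ℚ K] {F : PowerSeries K}
    (hF : PowerSeries.constantCoeff F = 1) : PowerSeries.constantCoeff (formalSqrt F) = 1 := by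
  have hs : PowerSeries.HasSubst (F - 1) :=
    PowerSeries.HasSubst.of_constantCoeff_zero' (by simp [hF])
  have h := PowerSeries.constantCoeff_subst hs (PowerSeries.binomialSeries K (1 / 2 : ℚ))
  refine h.trans ?_
  rw [finsum_eq_single _ 0]
  · simp
  · intro n hn
    have h1 : MvPowerSeries.constantCoeff (F - 1) = 0 := by
      change PowerSeries.constantCoeff (F - 1) = 0
      simp [hF]
    rw [map_pow, h1, zero_pow hn, smul_zero]

theorem eq_formalSqrt {K : Type*} [Field K] [Algebra ℚ K] {F S : PowerSeries K}
    (hS : PowerSeries.constantCoeff S = 1) (h : S ^ 2 = F) : S = formalSqrt F := by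
  have : CharZero K := algebraRat.charZero K
  have hF : PowerSeries.constantCoeff F = 1 := by rw [← h, map_pow, hS, one_pow]
  rcases sq_eq_sq_iff_eq_or_eq_neg.1 (h.trans (formalSqrt_sq hF).symm) with h | h
  · exact h
  · have := congrArg PowerSeries.constantCoeff h
    rw [map_neg, hS, constantCoeff_formalSqrt hF] at this
    norm_num at this

theorem map_polyExp (p : ℚ[X]) :
    PowerSeries.map (algebraMap ℚ[X] (RatFunc ℚ)) (polyExp p) =
      expMul (algebraMap ℚ[X] (RatFunc ℚ) p) := by
  rw [polyExp, expMul, ← PowerSeries.rescale_map, PowerSeries.map_exp]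

theorem map_eq_closedForm {T : PowerSeries ℚ[X]} (h : T * denom = PowerSeries.C (X - 1)) :
    PowerSeries.map (algebraMap ℚ[X] (RatFunc ℚ)) T = closedForm := by
  have h2 : PowerSeries.map (algebraMap ℚ[X] (RatFunc ℚ)) denom =
      PowerSeries.C RatFunc.X * expMul 2 - expMul (2 * RatFunc.X) := by
    simp [denom, map_polyExp, map_ofNat (algebraMap ℚ[X] (RatFunc ℚ))]
  rw [closedForm, PowerSeries.eq_mul_inv_iff_mul_eq, ← h2, ← map_mul, h]
  · simp
  · rw [← h2, ← PowerSeries.coeff_zero_eq_constantCoeff_apply, PowerSeries.coeff_map,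
      coeff_zero_denom]
    rw [Ne, FaithfulSMul.algebraMap_eq_zero_iff]
    exact X_sub_C_ne_zero (1 : ℚ)

/-! ### Derangements counted by excedances. -/

section Permutations

open Equiv

/-- Derangements of a set are modelled as permutations with that support, so the recursion stays
inside one permutation group. With j = π m, the permutation `swap m j * π` is π with m cut out of
its cycle; j stays in the support unless (m j) was a 2-cycle of π. -/
theorem sum_support_insert {α M : Type*} [Fintype α] [DecidableEq α] [AddCommMonoid M] {m : α}
    {A : Finset α} (hm : m ∉ A) (f : Perm α → M) :
    ∑ π : Perm α with π.support = insert m A, f π =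
      ∑ j ∈ A, ((∑ ρ : Perm α with ρ.support = A, f (swap m j * ρ)) +
        ∑ ρ : Perm α with ρ.support = A.erase j, f (swap m j * ρ)) := by
  have h1 : ∀ j ∈ A, (∑ ρ : Perm α with ρ.support = A, f (swap m j * ρ)) +
        ∑ ρ : Perm α with ρ.support = A.erase j, f (swap m j * ρ) =
      ∑ ρ : Perm α with ρ.support = A ∨ ρ.support = A.erase j, f (swap m j * ρ) := by
    intro j hj
    rw [Finset.filter_or, Finset.sum_union]
    rw [Finset.disjoint_filter]
    rintro ρ - h h'
    rw [h] at h'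
    exact Finset.notMem_erase j A (h' ▸ hj)
  rw [Finset.sum_congr rfl h1, Finset.sum_sigma']
  symm
  refine Finset.sum_bij' (fun p _ => swap m p.1 * p.2) (fun π _ => ⟨π m, swap m (π m) * π⟩)
    ?_ ?_ ?_ ?_ ?_
  · rintro ⟨j, ρ⟩ h
    simp only [Finset.mem_sigma, Finset.mem_filter, Finset.mem_univ, true_and] at h ⊢
    obtain ⟨hj, h⟩ := h
    have hinj := ρ.injective
    have hρm : ρ m = m := by
      rw [← Perm.notMem_support]
      rcases h with h | h <;> rw [h] <;> simp [hm]
    ext x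
    have hx : ρ x ≠ x ↔ x ∈ ρ.support := Perm.mem_support.symm
    have hxj : ρ x = j → ρ x = ρ j → x = j := fun _ h => hinj h
    have hxm : ρ x = m → x = m := fun h => hinj (h.trans hρm.symm)
    have hjj : ρ j ≠ j ↔ j ∈ ρ.support := Perm.mem_support.symm
    rw [Perm.mem_support, Perm.mul_apply, swap_apply_def, Finset.mem_insert]
    rcases h with h | h <;> rw [h] at hx hjj <;> grind
  · intro π h
    simp only [Finset.mem_sigma, Finset.mem_filter, Finset.mem_univ, true_and] at h ⊢
    have hs : ∀ x, π x ≠ x ↔ x = m ∨ x ∈ A := fun x => by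
      rw [← Perm.mem_support, h, Finset.mem_insert]
    have hinj := π.injective
    have hπm : π m ∈ A := by
      have h1 := (hs m).2 (Or.inl rfl)
      have h2 := (hs (π m)).1 (fun h => h1 (hinj h))
      exact h2.resolve_left h1
    refine ⟨hπm, ?_⟩
    -- In the positive case m lies in a 2-cycle, and cutting it out also fixes π m.
    by_cases hc : π (π m) = m
    · right
      ext x
      have := hs x
      have hxj : π x = π (π m) → x = π m := fun h => hinj h
      have hxm : π x = π m → x = m := fun h => hinj h
      rw [Perm.mem_support, Perm.mul_apply, swap_apply_def, Finset.mem_erase]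
      grind
    · left
      ext x
      have := hs x
      have hxm : π x = π m → x = m := fun h => hinj h
      rw [Perm.mem_support, Perm.mul_apply, swap_apply_def]
      grind
  · rintro ⟨j, ρ⟩ h
    simp only [Finset.mem_sigma, Finset.mem_filter, Finset.mem_univ, true_and] at h
    obtain ⟨hj, h⟩ := h
    have hρm : ρ m = m := by
      rw [← Perm.notMem_support]
      rcases h with h | h <;> rw [h] <;> simp [hm]
    simp [hρm]
  · intro π _
    simp
  · intro _ _
    rfl

/-- The arrow i → ρ i is replaced by i → m → ρ i: since m is larger than both, the first step is an
excedance and the second is not. -/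
theorem exc_swap_mul {n : ℕ} {ρ : Perm (Fin n)} {m i : Fin n} (hm : ρ m = m) (hi : i < m)
    (hρi : ρ i < m) : exc (swap m (ρ i) * ρ) = exc ρ + if i < ρ i then 0 else 1 := by
  have h : (Finset.univ.filter fun x => x < (swap m (ρ i) * ρ) x) =
      insert i (Finset.univ.filter fun x => x < ρ x) := by
    ext x
    have hxm : ρ x = m → x = m := fun h => ρ.injective (h.trans hm.symm)
    have hxi : ρ x = ρ i → x = i := fun h => ρ.injective h
    simp only [Finset.mem_filter, Finset.mem_univ, true_and, Finset.mem_insert, Perm.mul_apply,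
      swap_apply_def]
    grind
  rw [exc, h, exc]
  split_ifs with hlt
  · rw [Finset.insert_eq_of_mem (by simpa using hlt), add_zero]
  · rw [Finset.card_insert_of_notMem (by simpa using hlt)]

/-- With k = exc ρ, the insertion keeps the number of excedances at k arrows and raises it at |A| -
k, giving k x^k + (|A| - k) x^{k+1}. -/
theorem sum_exc_swap_mul {n : ℕ} {ρ : Perm (Fin n)} {m : Fin n} {A : Finset (Fin n)}
    (hA : ∀ a ∈ A, a < m) (hρ : ρ.support = A) :
    ∑ j ∈ A, (X : ℚ[X]) ^ exc (swap m j * ρ) =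
      (A.card : ℚ[X]) * X * X ^ exc ρ + X * (1 - X) * derivative (X ^ exc ρ) := by
  have hmap : ∀ i, i ∈ A ↔ ρ i ∈ A := fun i => by rw [← hρ, Perm.apply_mem_support]
  have hm : ρ m = m := by
    rw [← Perm.notMem_support, hρ]
    exact fun h => lt_irrefl _ (hA m h)
  have h1 : ∑ j ∈ A, (X : ℚ[X]) ^ exc (swap m j * ρ) =
      ∑ i ∈ A, if i < ρ i then X ^ exc ρ else X ^ (exc ρ + 1) := by
    symm
    refine Finset.sum_bij (fun i _ => ρ i) (fun i hi => (hmap i).1 hi)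
      (fun _ _ _ _ h => ρ.injective h)
      (fun j hj => ⟨ρ.symm j, (hmap _).2 (by simpa using hj), by simp⟩) fun i hi => ?_
    rw [exc_swap_mul hm (hA i hi) (hA _ ((hmap i).1 hi))]
    split_ifs <;> simp
  have h2 : exc ρ = (A.filter fun i => i < ρ i).card := by
    rw [exc]
    congr 1
    ext i
    simp only [Finset.mem_filter, Finset.mem_univ, true_and]
    refine ⟨fun h => ⟨?_, h⟩, fun h => h.2⟩
    rw [← hρ, Perm.mem_support]
    exact h.ne'
  have h3 := Finset.card_filter_add_card_filter_not (s := A) (fun i => i < ρ i)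
  rw [h1, Finset.sum_ite, Finset.sum_const, Finset.sum_const, ← h3, ← h2]
  simp only [nsmul_eq_mul, derivative_X_pow]
  push_cast
  rcases exc ρ with _ | k
  · simp
  · simp
    ring

theorem sum_support_eq_derPoly {n : ℕ} (k : ℕ) (A : Finset (Fin n)) (hA : A.card = k) :
    ∑ π : Perm (Fin n) with π.support = A, (X : ℚ[X]) ^ exc π = derPoly k := by
  induction k using Nat.strong_induction_on generalizing A with
  | _ k ih =>
    rcases A.eq_empty_or_nonempty with rfl | hne
    · obtain rfl : k = 0 := by simpa using hA.symm
      have : (Finset.univ.filter fun π : Perm (Fin n) => π.support = ∅) = {1} := by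
        ext π; simp
      rw [this, Finset.sum_singleton, derPoly]
      simp [exc]
    · set m := A.max' hne with hmdef
      set B := A.erase m with hB
      have hAB : A = insert m B := (Finset.insert_erase (A.max'_mem hne)).symm
      have hBm : ∀ a ∈ B, a < m := fun a ha => Finset.lt_max'_of_mem_erase_max' A hne ha
      have hmB : m ∉ B := Finset.notMem_erase _ _
      have hc : B.card + 1 = k := by rw [← hA, hAB, Finset.card_insert_of_notMem hmB]
      rw [hAB, sum_support_insert hmB, Finset.sum_add_distrib, Finset.sum_comm,
        Finset.sum_congr rfl fun ρ hρ =>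
          sum_exc_swap_mul hBm (Finset.mem_filter.1 hρ).2, Finset.sum_add_distrib,
        ← Finset.mul_sum, ← Finset.mul_sum, ← derivative_sum, ih B.card (by omega) B rfl]
      -- Here j is fixed by ρ, so the new 2-cycle (m j) contributes exactly one excedance, j → m.
      have h2 : ∀ j ∈ B, ∑ ρ : Perm (Fin n) with ρ.support = B.erase j,
          (X : ℚ[X]) ^ exc (swap m j * ρ) = X * derPoly (B.card - 1) := by
        intro j hj
        rw [← ih (B.card - 1) (by omega) (B.erase j) (Finset.card_erase_of_mem hj), Finset.mul_sum]
        refine Finset.sum_congr rfl fun ρ hρ => ?_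
        have hρ := (Finset.mem_filter.1 hρ).2
        have hρj : ρ j = j := by
          rw [← Perm.notMem_support, hρ]; simp
        have hρm : ρ m = m := by
          rw [← Perm.notMem_support, hρ]; simp [hmB]
        have := exc_swap_mul (i := j) hρm (hBm j hj) (by rw [hρj]; exact hBm j hj)
        rw [hρj, if_neg (lt_irrefl j)] at this
        rw [this, pow_succ']
      rw [Finset.sum_congr rfl h2, Finset.sum_const, ← hc, nsmul_eq_mul]
      rcases B.card with _ | c
      · simp [derPoly]
      · rw [derPoly]
        push_cast
        ring

theorem d_eq_derPoly : d = derPoly := by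
  funext n
  rw [← sum_support_eq_derPoly n (Finset.univ : Finset (Fin n)) (by simp), d]
  refine Finset.sum_congr ?_ fun _ _ => rfl
  ext π
  simp [derangements, Finset.ext_iff]

end Permutations

/-! ### Single cycles counted by ascent plateaus. -/

/-- All words obtained from `w` by inserting the block `m m` somewhere after the first letter. -/
def blockInsertions (m : ℕ) : List ℕ → List (List ℕ)
  | [] => []
  | a :: l => (a :: m :: m :: l) :: (blockInsertions m l).map (a :: ·)

theorem mem_blockInsertions {m : ℕ} {w u : List ℕ} :
    u ∈ blockInsertions m w ↔ ∃ s t, s ≠ [] ∧ w = s ++ t ∧ u = s ++ m :: m :: t := by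
  induction w generalizing u with
  | nil =>
    simp only [blockInsertions, List.not_mem_nil, false_iff]
    rintro ⟨s, t, hs, h, -⟩
    exact hs (List.append_eq_nil_iff.1 h.symm).1
  | cons a l ih =>
    simp only [blockInsertions, List.mem_cons, List.mem_map, ih]
    constructor
    · rintro (rfl | ⟨v, ⟨s, t, hs, rfl, rfl⟩, rfl⟩)
      · exact ⟨[a], l, by simp, rfl, rfl⟩
      · exact ⟨a :: s, t, by simp, rfl, rfl⟩
    · rintro ⟨s, t, hs, h, rfl⟩
      obtain ⟨b, s, rfl⟩ := List.exists_cons_of_ne_nil hs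
      simp only [List.cons_append, List.cons.injEq] at h
      obtain ⟨rfl, rfl⟩ := h
      rcases s with _ | ⟨b, s⟩
      · left; rfl
      · right
        exact ⟨_, ⟨b :: s, t, by simp, rfl, rfl⟩, rfl⟩

theorem nodup_blockInsertions {m : ℕ} {w : List ℕ} (hm : m ∉ w) : (blockInsertions m w).Nodup := by
  induction w with
  | nil => simp [blockInsertions]
  | cons a l ih =>
    rw [List.mem_cons, not_or] at hm
    rw [blockInsertions, List.nodup_cons]
    refine ⟨?_, (ih hm.2).map (List.cons_injective)⟩
    rw [List.mem_map]
    rintro ⟨v, hv, h⟩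
    obtain ⟨s, t, hs, rfl, rfl⟩ := mem_blockInsertions.1 hv
    obtain ⟨b, s, rfl⟩ := List.exists_cons_of_ne_nil hs
    simp only [List.cons_append, List.cons.injEq, true_and] at h
    exact hm.2 (by simp [h.1])

theorem filter_of_mem_blockInsertions {m : ℕ} {w u : List ℕ} (hm : m ∉ w)
    (hu : u ∈ blockInsertions m w) : u.filter (· ≠ m) = w := by
  obtain ⟨s, t, -, rfl, rfl⟩ := mem_blockInsertions.1 hu
  have h : ∀ l : List ℕ, m ∉ l → l.filter (· ≠ m) = l := fun l hl =>
    List.filter_eq_self.2 fun a ha => by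
      simpa using fun h : a = m => hl (h ▸ ha)
  rw [List.mem_append, not_or] at hm
  have h1 := h s hm.1
  have h2 := h t hm.2
  simp only [ne_eq, decide_not] at h1 h2
  simp [h1, h2]

theorem capCycle_cons_of_le {m : ℕ} {l : List ℕ} (h : ∀ a ∈ l, a ≤ m) :
    capCycle (m :: l) = capCycle l := by
  rcases l with _ | ⟨b, _ | ⟨c, l⟩⟩
  · rfl
  · rfl
  · rw [capCycle, if_neg, zero_add]
    rintro ⟨h1, -⟩
    exact absurd (h b (by simp)) (by omega)

/-- The inserted block always creates a plateau. It destroys an old one exactly when it lands just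
before or between the two equal letters of that plateau, so 2 cap(w) of the gaps keep the statistic
and the other gaps raise it by 1. -/
theorem sum_capCycle_blockInsertions {m : ℕ} {w : List ℕ} (hm : ∀ a ∈ w, a < m) :
    ((blockInsertions m w).map fun u => (X : ℚ[X]) ^ capCycle u).sum =
      2 * (capCycle w : ℚ[X]) * X ^ capCycle w +
        ((w.length : ℚ[X]) - 2 * (capCycle w : ℚ[X])) * X ^ (capCycle w + 1) := by
  have top : ∀ a l, a < m → (∀ b ∈ l, b < m) →
      capCycle (a :: m :: m :: l) = 1 + capCycle l := by
    intro a l ha hl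
    rw [capCycle, if_pos ⟨ha, rfl⟩, capCycle_cons_of_le, capCycle_cons_of_le]
    · exact fun b hb => (hl b hb).le
    · intro b hb
      rcases List.mem_cons.1 hb with rfl | hb
      exacts [le_rfl, (hl b hb).le]
  induction w with
  | nil => simp [blockInsertions, capCycle]
  | cons a l ih =>
    have ha : a < m := hm a (by simp)
    have hl : ∀ b ∈ l, b < m := fun b hb => hm b (by simp [hb])
    specialize ih hl
    rw [blockInsertions, List.map_cons, List.sum_cons, List.map_map, top a l ha hl]
    rcases l with _ | ⟨b, l⟩
    · simp [blockInsertions, capCycle]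
    have hb : b < m := hl b (by simp)
    have hl' : ∀ c ∈ l, c < m := fun c hc => hl c (by simp [hc])
    have htop1 : capCycle (a :: b :: m :: m :: l) = capCycle (b :: m :: m :: l) := by
      rw [capCycle, if_neg (by rintro ⟨-, h⟩; omega), zero_add]
    -- The split is on whether a starts a plateau a < b = b. If so, only insertions right after a or
    -- right after the first b destroy it. If not, a leading a has no effect, even after an
    -- insertion beyond b.
    by_cases hp : a < b ∧ l.head? = some b
    · obtain ⟨hab, hlb⟩ := hp
      obtain ⟨l, rfl⟩ : ∃ l', l = b :: l' := by
        rcases l with _ | ⟨c, l⟩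
        · simp at hlb
        · simp only [List.head?_cons, Option.some.injEq] at hlb
          exact ⟨l, by rw [hlb]⟩
      have h0 : capCycle (b :: b :: l) = capCycle (b :: l) := by
        rcases l with _ | ⟨c, l⟩
        · rfl
        · rw [capCycle, if_neg (by rintro ⟨h, -⟩; omega), zero_add]
      have h1 : capCycle (a :: b :: b :: l) = 1 + capCycle (b :: b :: l) := by
        rw [capCycle, if_pos ⟨hab, rfl⟩]
      have h2 : ∀ u ∈ blockInsertions m (b :: l),
          capCycle (a :: b :: u) = 1 + capCycle (b :: u) := by
        intro u hu
        obtain ⟨s, t, hs, h, rfl⟩ := mem_blockInsertions.1 hu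
        obtain ⟨b', s, rfl⟩ := List.exists_cons_of_ne_nil hs
        simp only [List.cons_append, List.cons.injEq] at h
        obtain ⟨rfl, -⟩ := h
        rw [List.cons_append, capCycle, if_pos ⟨hab, rfl⟩]
      rw [blockInsertions, List.map_cons, List.sum_cons, List.map_map] at ih ⊢
      rw [top b _ hb hl'] at ih
      have h3 : ((blockInsertions m (b :: l)).map
            (((fun u => (X : ℚ[X]) ^ capCycle u) ∘ fun x => a :: x) ∘ fun x => b :: x)).sum =
          X * ((blockInsertions m (b :: l)).map
            ((fun u => (X : ℚ[X]) ^ capCycle u) ∘ fun x => b :: x)).sum := by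
        rw [← List.sum_map_mul_left]
        refine congrArg _ (List.map_congr_left fun u hu => ?_)
        simp only [Function.comp_apply]
        rw [h2 u hu]
        ring
      rw [h3, Function.comp_apply, htop1, top b _ hb hl', h1]
      rw [h0] at ih ⊢
      simp only [List.length_cons] at ih ⊢
      push_cast at ih ⊢
      linear_combination X * ih
    · have h1 : ∀ u, (u = b :: l ∨ u ∈ blockInsertions m (b :: l)) →
          capCycle (a :: u) = capCycle u := by
        intro u hu
        have key : ∀ v, (a < b → v.head? ≠ some b) →
            capCycle (a :: b :: v) = capCycle (b :: v) := by
          intro v hv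
          rcases v with _ | ⟨c, v⟩
          · rfl
          · rw [capCycle, if_neg, zero_add]
            rintro ⟨h, rfl⟩
            exact hv h rfl
        rcases hu with rfl | hu
        · exact key l fun h h' => hp ⟨h, h'⟩
        · obtain ⟨s, t, hs, h, rfl⟩ := mem_blockInsertions.1 hu
          obtain ⟨b', s, rfl⟩ := List.exists_cons_of_ne_nil hs
          simp only [List.cons_append, List.cons.injEq] at h
          obtain ⟨rfl, rfl⟩ := h
          refine key _ fun h h' => ?_
          rcases s with _ | ⟨c, s⟩
          · simp at h'; omega
          · exact hp ⟨h, by simpa using h'⟩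
      have h3 : ((blockInsertions m (b :: l)).map
            ((fun u => (X : ℚ[X]) ^ capCycle u) ∘ fun x => a :: x)).sum =
          ((blockInsertions m (b :: l)).map fun u => (X : ℚ[X]) ^ capCycle u).sum := by
        refine congrArg _ (List.map_congr_left fun u hu => ?_)
        simp only [Function.comp_apply]
        rw [h1 u (Or.inr hu)]
      rw [h3, ih, h1 _ (Or.inl rfl)]
      simp only [List.length_cons]
      push_cast
      ring

/-- `w` is a Stirling permutation of the multiset `B ∪ B` starting with a smallest letter. -/
structure IsCycleWord (B : Finset ℕ) (w : List ℕ) : Prop where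
  entries : (w : Multiset ℕ) = 2 • B.val
  stirling : ∀ i j : ℕ, List.Sublist [i, j, i] w → i < j
  head_le : ∀ a ∈ w, w.headI ≤ a

theorem IsCycleWord.mem_iff {B : Finset ℕ} {w : List ℕ} (h : IsCycleWord B w) {a : ℕ} :
    a ∈ w ↔ a ∈ B := by
  rw [← Multiset.mem_coe, h.entries, Multiset.mem_nsmul_of_ne_zero two_ne_zero, Finset.mem_val]

theorem IsCycleWord.toFinset_eq {B : Finset ℕ} {w : List ℕ} (h : IsCycleWord B w) :
    w.toFinset = B := by
  ext a
  rw [List.mem_toFinset, h.mem_iff]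

theorem IsCycleWord.length_eq {B : Finset ℕ} {w : List ℕ} (h : IsCycleWord B w) :
    w.length = 2 * B.card := by
  simpa using congrArg Multiset.card h.entries

open Classical in
/-- The finite set of cycle words on the letters `B`. -/
def cycleWords (B : Finset ℕ) : Finset (List ℕ) :=
  (Multiset.lists (2 • B.val)).toFinset.filter (IsCycleWord B)

theorem mem_cycleWords {B : Finset ℕ} {w : List ℕ} : w ∈ cycleWords B ↔ IsCycleWord B w := by
  simp only [cycleWords, Finset.mem_filter, Multiset.mem_toFinset, Multiset.mem_lists_iff]
  exact ⟨fun h => h.2, fun h => ⟨h.entries.symm, h⟩⟩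

/-- Nothing exceeds the largest letter m, so its two copies are adjacent. They are not in front,
because the word starts with a smallest letter and B is nonempty. -/
theorem isCycleWord_insert {B : Finset ℕ} (hB : B.Nonempty) {m : ℕ} (hm : ∀ a ∈ B, a < m)
    {u : List ℕ} :
    IsCycleWord (insert m B) u ↔ ∃ w, IsCycleWord B w ∧ u ∈ blockInsertions m w := by
  have hmB : m ∉ B := fun h => lt_irrefl _ (hm m h)
  have hent : ∀ s t : List ℕ, ((s ++ m :: m :: t : List ℕ) : Multiset ℕ) = 2 • (insert m B).val ↔
      ((s ++ t : List ℕ) : Multiset ℕ) = 2 • B.val := by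
    intro s t
    have h1 : ((s ++ m :: m :: t : List ℕ) : Multiset ℕ) =
        2 • {m} + ((s ++ t : List ℕ) : Multiset ℕ) := by
      rw [← Multiset.coe_add, ← Multiset.coe_add, ← Multiset.cons_coe, ← Multiset.cons_coe,
        ← Multiset.singleton_add, ← Multiset.singleton_add, two_nsmul]
      abel
    rw [h1, Finset.insert_val_of_notMem hmB, ← Multiset.singleton_add, nsmul_add]
    exact add_right_inj _
  have hhead : ∀ s t : List ℕ, s ≠ [] → (s ++ m :: m :: t).headI = (s ++ t).headI := by
    intro s t hs
    obtain ⟨b, s, rfl⟩ := List.exists_cons_of_ne_nil hs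
    rfl
  constructor
  · intro h
    have hmu : m ∈ u := h.mem_iff.2 (by simp)
    have hcount : u.count m = 2 := by
      rw [← Multiset.coe_count, h.entries, Multiset.count_nsmul, Multiset.count_eq_one_of_mem
        (Finset.nodup _) (by simp)]
    obtain ⟨s, t, rfl, hms⟩ := List.eq_append_cons_of_mem hmu
    have hmt : m ∈ t := by
      rw [List.count_append, List.count_eq_zero_of_not_mem hms, List.count_cons_self] at hcount
      exact List.count_pos_iff.1 (by omega)
    obtain ⟨t₁, t, rfl, -⟩ := List.eq_append_cons_of_mem hmt
    obtain rfl : t₁ = [] := by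
      rcases t₁ with _ | ⟨j, t₁⟩
      · rfl
      · exfalso
        have hlt : m < j := by
          refine h.stirling m j (List.Sublist.trans ?_ (List.sublist_append_right _ _))
          simp
        have hj : j ∈ insert m B := h.mem_iff.1 (by simp)
        rcases Finset.mem_insert.1 hj with rfl | hj
        · exact lt_irrefl _ hlt
        · exact lt_asymm hlt (hm j hj)
    rw [List.nil_append] at h ⊢
    have hs : s ≠ [] := by
      rintro rfl
      obtain ⟨b, hb⟩ := hB
      have := h.head_le b (h.mem_iff.2 (by simp [hb]))
      exact absurd (hm b hb) (by simpa using this)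
    have hsub : List.Sublist (s ++ t) (s ++ m :: m :: t) :=
      List.Sublist.append_left ((List.sublist_cons_self _ _).trans (List.sublist_cons_self _ _)) _
    refine ⟨s ++ t, ⟨(hent s t).1 h.entries, fun i j hij => h.stirling i j (hij.trans hsub),
      fun a ha => ?_⟩, mem_blockInsertions.2 ⟨s, t, hs, rfl, rfl⟩⟩
    rw [← hhead s t hs]
    exact h.head_le a (hsub.subset ha)
  · rintro ⟨w, h, hu⟩
    have hmw : m ∉ w := fun hw => hmB (h.mem_iff.1 hw)
    have hfil := filter_of_mem_blockInsertions hmw hu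
    obtain ⟨s, t, hs, rfl, rfl⟩ := mem_blockInsertions.1 hu
    have hlt : ∀ a, a ∈ s ++ t → a < m := fun a ha => hm a (h.mem_iff.1 ha)
    have hmem : ∀ a, a ∈ s ++ m :: m :: t ↔ a = m ∨ a ∈ s ++ t := by
      intro a; simp; tauto
    refine ⟨(hent s t).2 h.entries, fun i j hij => ?_, fun a ha => ?_⟩
    · by_cases him : i = m
      · exfalso
        subst him
        rw [List.mem_append, not_or] at hmw
        obtain ⟨l₁, l₂, hl, h₁, h₂⟩ := List.sublist_append_iff.1 hij
        rcases l₁ with _ | ⟨a, l₁⟩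
        · rw [List.nil_append] at hl
          subst hl
          rw [List.cons_sublist_cons] at h₂
          have h₃ : List.Sublist [i] t := by
            cases h₂ with
            | cons _ h₂ => exact (List.sublist_cons_self _ _).trans h₂
            | cons_cons _ h₂ => exact h₂
          exact hmw.2 (h₃.subset (by simp))
        · rw [List.cons_append, List.cons.injEq] at hl
          exact hmw.1 (h₁.subset (by simp [hl.1]))
      · have hi : i < m := hlt i (((hmem i).1 (hij.subset (by simp))).resolve_left him)
        by_cases hjm : j = m
        · rw [hjm]; exact hi
        · have := hij.filter (· ≠ m)
          rw [hfil] at this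
          exact h.stirling i j (by simpa [him, hjm] using this)
    · rw [hhead s t hs]
      rcases (hmem a).1 ha with rfl | ha
      · obtain ⟨b, s, rfl⟩ := List.exists_cons_of_ne_nil hs
        exact (hlt b (by simp)).le
      · exact h.head_le a ha

theorem sum_cycleWords (n : ℕ) (B : Finset ℕ) (hB : B.card = n + 1) :
    ∑ w ∈ cycleWords B, (X : ℚ[X]) ^ capCycle w = cyclePoly n := by
  induction n generalizing B with
  | zero =>
    obtain ⟨a, rfl⟩ := Finset.card_eq_one.1 hB
    have : cycleWords {a} = {[a, a]} := by
      ext w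
      rw [mem_cycleWords, Finset.mem_singleton]
      constructor
      · intro h
        have h1 : (w : Multiset ℕ) = (List.replicate 2 a : List ℕ) := by
          rw [h.entries]; rfl
        exact List.perm_replicate.1 (Multiset.coe_eq_coe.1 h1)
      · rintro rfl
        refine ⟨rfl, fun i j hij => ?_, by simp⟩
        have := hij.length_le
        simp at this
    rw [this, Finset.sum_singleton, cyclePoly]
    simp [capCycle]
  | succ n ih =>
    have hne : B.Nonempty := Finset.card_pos.1 (by omega)
    set m := B.max' hne with hmdef
    set A := B.erase m with hA
    have hAB : B = insert m A := (Finset.insert_erase (B.max'_mem hne)).symm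
    have hAm : ∀ a ∈ A, a < m := fun a ha => Finset.lt_max'_of_mem_erase_max' B hne ha
    have hmA : m ∉ A := Finset.notMem_erase _ _
    have hc : A.card = n + 1 := by
      rw [hAB, Finset.card_insert_of_notMem hmA] at hB
      omega
    have hAne : A.Nonempty := Finset.card_pos.1 (by omega)
    have hun : cycleWords B = (cycleWords A).biUnion fun w => (blockInsertions m w).toFinset := by
      ext u
      rw [hAB, mem_cycleWords, isCycleWord_insert hAne hAm]
      simp [mem_cycleWords]
    have hnot : ∀ w ∈ cycleWords A, m ∉ w := fun w hw h =>
      hmA ((mem_cycleWords.1 hw).mem_iff.1 h)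
    rw [hun, Finset.sum_biUnion]
    · rw [cyclePoly, ← ih A hc, derivative_sum, Finset.mul_sum, Finset.mul_sum,
        ← Finset.sum_add_distrib]
      refine Finset.sum_congr rfl fun w hw => ?_
      have hw' := mem_cycleWords.1 hw
      rw [List.sum_toFinset _ (nodup_blockInsertions (hnot w hw)),
        sum_capCycle_blockInsertions fun a ha => hAm a (hw'.mem_iff.1 ha), hw'.length_eq, hc,
        derivative_X_pow]
      push_cast
      rcases capCycle w with _ | k
      · simp
      · simp
        ring
    -- Deleting m recovers the original word, so different words have disjoint sets of insertions.
    · intro w hw w' hw' hne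
      rw [Function.onFun, Finset.disjoint_left]
      intro u hu hu'
      rw [List.mem_toFinset] at hu hu'
      exact hne ((filter_of_mem_blockInsertions (hnot w hw) hu).symm.trans
        (filter_of_mem_blockInsertions (hnot w' hw') hu'))

/-! ### Arbitrary label sets in place of reductions. -/

/-- Stirling derangements with an arbitrary finite set `A` of labels. -/
structure IsLabelledDerangement (A : Finset ℕ) (σ : List (List ℕ)) : Prop where
  entries : (σ.flatten : Multiset ℕ) = 2 • A.val
  cycle : ∀ c ∈ σ, IsCycleWord c.toFinset c ∧ 2 ≤ c.toFinset.card
  increasing : σ.Pairwise fun c c' => c.headI < c'.headI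

theorem headI_mem {c : List ℕ} (h : c ≠ []) : c.headI ∈ c := by
  obtain ⟨a, l, rfl⟩ := List.exists_cons_of_ne_nil h
  simp

/-- The rank of the letter `a` in the finite set `S`. -/
abbrev rank (S : Finset ℕ) (a : ℕ) : ℕ := (S.filter (· ≤ a)).card

theorem rank_lt_rank_iff {S : Finset ℕ} {a b : ℕ} (hb : b ∈ S) :
    rank S a < rank S b ↔ a < b := by
  constructor
  · intro h
    by_contra! hle
    refine absurd (Finset.card_le_card fun x hx => ?_) (not_le.2 h)
    rw [Finset.mem_filter] at hx ⊢
    exact ⟨hx.1, hx.2.trans hle⟩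
  · intro h
    refine Finset.card_lt_card (Finset.ssubset_iff_of_subset ?_ |>.2 ⟨b, ?_, ?_⟩)
    · intro x hx
      rw [Finset.mem_filter] at hx ⊢
      exact ⟨hx.1, hx.2.trans h.le⟩
    · simp [hb]
    · simp [hb, h]

theorem rank_injOn {S : Finset ℕ} {a b : ℕ} (ha : a ∈ S) (hb : b ∈ S)
    (h : rank S a = rank S b) : a = b := by
  rcases lt_trichotomy a b with hab | hab | hab
  · exact absurd ((rank_lt_rank_iff hb).2 hab) (by omega)
  · exact hab
  · exact absurd ((rank_lt_rank_iff ha).2 hab) (by omega)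

theorem image_rank (S : Finset ℕ) : S.image (rank S) = Finset.Icc 1 S.card := by
  refine Finset.eq_of_subset_of_card_le ?_ ?_
  · intro x hx
    obtain ⟨a, ha, rfl⟩ := Finset.mem_image.1 hx
    rw [Finset.mem_Icc]
    exact ⟨Finset.card_pos.2 ⟨a, by simp [ha]⟩, Finset.card_le_card (Finset.filter_subset _ _)⟩
  · rw [Finset.card_image_of_injOn fun a ha b hb h => rank_injOn ha hb h]
    simp

theorem red_eq_map_rank (c : List ℕ) : red c = c.map (rank c.toFinset) := rfl

/-- Reduction is the rank map, injective and order preserving on the letters of c, so the Stirling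
condition can be tested on c itself. -/
theorem exists_isStirlingPerm_red_iff (c : List ℕ) :
    (∃ k, c.length = 2 * k ∧ IsStirlingPerm k (red c)) ↔
      (c : Multiset ℕ) = 2 • c.toFinset.val ∧ ∀ i j : ℕ, List.Sublist [i, j, i] c → i < j := by
  have himg : c.toFinset.val.map (rank c.toFinset) = (Finset.Icc 1 c.toFinset.card).val := by
    rw [← image_rank, Finset.image_val_of_injOn fun a ha b hb h => rank_injOn ha hb h]
  constructor
  · rintro ⟨k, hk, hent, hst⟩
    constructor
    · ext a
      rw [Multiset.count_nsmul, Multiset.coe_count]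
      by_cases ha : a ∈ c
      · have haS := List.mem_toFinset.2 ha
        rw [Multiset.count_eq_one_of_mem (Finset.nodup _) haS]
        have h1 : (red c).count (rank c.toFinset a) = c.count a := by
          rw [red_eq_map_rank, List.count, List.count, List.countP_map]
          refine List.countP_congr fun b hb => ?_
          simp only [Function.comp_apply, beq_iff_eq]
          exact ⟨fun h => rank_injOn (List.mem_toFinset.2 hb) haS h, fun h => by rw [h]⟩
        have h2 : rank c.toFinset a ∈ (red c : Multiset ℕ) := by
          rw [Multiset.mem_coe, red_eq_map_rank]
          exact List.mem_map_of_mem ha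
        rw [← h1, ← Multiset.coe_count]
        rw [hent] at h2 ⊢
        rw [Multiset.count_nsmul, Multiset.count_eq_one_of_mem (Finset.nodup _)
          (Multiset.mem_of_mem_nsmul h2)]
      · rw [List.count_eq_zero_of_not_mem ha, Multiset.count_eq_zero_of_notMem, mul_zero]
        simpa using ha
    · intro i j hij
      have := hst _ _ (hij.map (rank c.toFinset))
      exact (rank_lt_rank_iff (List.mem_toFinset.2 (hij.subset (by simp)))).1 this
  · rintro ⟨hent, hst⟩
    refine ⟨c.toFinset.card, ?_, ?_, fun i j hij => ?_⟩
    · rw [← Multiset.coe_card, hent, Multiset.card_nsmul, Finset.card_val]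
    · rw [red_eq_map_rank, ← Multiset.map_coe, hent, Multiset.map_nsmul, himg]
    · rw [red_eq_map_rank, List.sublist_map_iff] at hij
      obtain ⟨l, hl, hmap⟩ := hij
      obtain ⟨i₁, l, rfl⟩ := List.exists_cons_of_ne_nil (l := l) (by rintro rfl; simp at hmap)
      obtain ⟨j₁, l, rfl⟩ := List.exists_cons_of_ne_nil (l := l) (by rintro rfl; simp at hmap)
      obtain ⟨i₂, l, rfl⟩ := List.exists_cons_of_ne_nil (l := l) (by rintro rfl; simp at hmap)
      simp only [List.map_cons, List.cons.injEq, List.nil_eq, List.map_eq_nil_iff] at hmap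
      obtain ⟨rfl, rfl, h, rfl⟩ := hmap
      have hmem : ∀ x ∈ [i₁, j₁, i₂], x ∈ c.toFinset := fun x hx =>
        List.mem_toFinset.2 (hl.subset hx)
      obtain rfl := rank_injOn (hmem i₁ (by simp)) (hmem i₂ (by simp)) h
      exact (rank_lt_rank_iff (hmem j₁ (by simp))).2 (hst _ _ hl)

theorem isCycleWord_toFinset_iff (c : List ℕ) :
    IsCycleWord c.toFinset c ↔
      (∃ k, c.length = 2 * k ∧ IsStirlingPerm k (red c)) ∧ ∀ a ∈ c, c.headI ≤ a := by
  rw [exists_isStirlingPerm_red_iff]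
  exact ⟨fun h => ⟨⟨h.entries, h.stirling⟩, h.head_le⟩, fun h => ⟨h.1.1, h.1.2, h.2⟩⟩

/-- A cycle word with only one distinct letter a is (a, a), so having no fixed points means that
every cycle has at least two distinct letters. -/
theorem isStirlingDerangement_iff {n : ℕ} {σ : List (List ℕ)} :
    IsStirlingDerangement n σ ↔ IsLabelledDerangement (Finset.Icc 1 n) σ := by
  constructor
  · rintro ⟨h, hfix⟩
    refine ⟨h.entries, fun c hc => ?_, h.increasing⟩
    have hw : IsCycleWord c.toFinset c :=
      (isCycleWord_toFinset_iff c).2 ⟨h.stirling c hc, h.head_le c hc⟩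
    refine ⟨hw, ?_⟩
    by_contra! hlt
    have hpos : 0 < c.toFinset.card := Finset.card_pos.2
      ⟨c.headI, List.mem_toFinset.2 (headI_mem (h.cycle_ne_nil c hc))⟩
    obtain ⟨a, ha⟩ := Finset.card_eq_one.1 (show c.toFinset.card = 1 by omega)
    have hca : c = [a, a] := by
      have h1 : (c : Multiset ℕ) = (List.replicate 2 a : List ℕ) := by
        rw [hw.entries, ha]; rfl
      exact List.perm_replicate.1 (Multiset.coe_eq_coe.1 h1)
    have haI : a ∈ (σ.flatten : Multiset ℕ) :=
      Multiset.mem_coe.2 (List.mem_flatten.2 ⟨c, hc, by simp [hca]⟩)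
    rw [h.entries] at haI
    rw [hca] at hc
    exact hfix a (Multiset.mem_of_mem_nsmul haI) hc
  · intro h
    have hcyc : ∀ c ∈ σ, _ := fun c hc => (isCycleWord_toFinset_iff c).1 (h.cycle c hc).1
    refine ⟨⟨h.entries, fun c hc hnil => ?_, fun i hi => ?_, fun c hc => (hcyc c hc).2,
      h.increasing, fun c hc => (hcyc c hc).1⟩, fun k _ hk => ?_⟩
    · have := (h.cycle c hc).2
      simp [hnil] at this
    · have hi' : i ∈ (σ.flatten : Multiset ℕ) := by
        rw [h.entries, Multiset.mem_nsmul_of_ne_zero two_ne_zero]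
        exact hi
      obtain ⟨c, hc, hic⟩ := List.mem_flatten.1 (Multiset.mem_coe.1 hi')
      refine ⟨c, hc, ?_⟩
      rw [← Multiset.coe_count, (h.cycle c hc).1.entries, Multiset.count_nsmul,
        Multiset.count_eq_one_of_mem (Finset.nodup _) (by simpa using hic)]
    · have := (h.cycle _ hk).2
      simp at this

theorem IsLabelledDerangement.cycle_ne_nil {A : Finset ℕ} {σ : List (List ℕ)}
    (h : IsLabelledDerangement A σ) {c : List ℕ} (hc : c ∈ σ) : c ≠ [] := by
  rintro rfl
  have := (h.cycle _ hc).2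
  simp at this

theorem IsLabelledDerangement.mem_label {A : Finset ℕ} {σ : List (List ℕ)}
    (h : IsLabelledDerangement A σ) {c : List ℕ} (hc : c ∈ σ) {a : ℕ} (ha : a ∈ c) : a ∈ A := by
  have h1 : a ∈ (σ.flatten : Multiset ℕ) :=
    Multiset.mem_coe.2 (List.mem_flatten.2 ⟨c, hc, ha⟩)
  rw [h.entries] at h1
  exact Multiset.mem_of_mem_nsmul h1

theorem finite_labelledDerangements (A : Finset ℕ) : {σ | IsLabelledDerangement A σ}.Finite := by
  refine (finite_lists (finite_lists A.finite_toSet (2 * A.card)) (2 * A.card)).subset ?_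
  intro σ h
  have hlen : (σ.map List.length).sum = 2 * A.card := by
    simpa [List.length_flatten] using congrArg Multiset.card h.entries
  refine ⟨?_, fun c hc => ⟨?_, fun a ha => h.mem_label hc ha⟩⟩
  · rw [← hlen]
    simpa using List.length_le_sum_of_one_le (σ.map List.length) (by
      intro i hi
      obtain ⟨c, hc, rfl⟩ := List.mem_map.1 hi
      exact List.length_pos_iff.2 (h.cycle_ne_nil hc))
  · rw [← hlen]
    exact List.le_sum_of_mem (List.mem_map_of_mem hc)

/-- The finite set of Stirling derangements labelled by `A`. -/
def labelledDerangements (A : Finset ℕ) : Finset (List (List ℕ)) :=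
  (finite_labelledDerangements A).toFinset

theorem mem_labelledDerangements {A : Finset ℕ} {σ : List (List ℕ)} :
    σ ∈ labelledDerangements A ↔ IsLabelledDerangement A σ := by
  simp [labelledDerangements]

theorem stirlingDerangements_eq (n : ℕ) :
    stirlingDerangements n = labelledDerangements (Finset.Icc 1 n) := by
  ext σ
  simp [stirlingDerangements, mem_labelledDerangements, isStirlingDerangement_iff]

/-! ### Removing the cycle of the smallest letter. -/

theorem insert_val_add_sdiff_val {a : ℕ} {A B : Finset ℕ} (ha : a ∉ A) (hB : B ⊆ A) :
    (insert a B).val + (A \ B).val = (insert a A).val := by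
  have hd : Disjoint (insert a B) (A \ B) := by
    rw [Finset.disjoint_insert_left]
    exact ⟨fun h => ha (Finset.mem_sdiff.1 h).1, Finset.disjoint_sdiff⟩
  rw [← Finset.disjUnion_val _ _ hd]
  congr 1
  ext x
  have := @hB x
  simp only [Finset.mem_disjUnion, Finset.mem_insert, Finset.mem_sdiff]
  tauto

theorem isLabelledDerangement_cons {a : ℕ} {A B : Finset ℕ} (ha : ∀ b ∈ A, a < b) (hB : B ⊆ A)
    (hne : B.Nonempty) {c : List ℕ} {σ : List (List ℕ)} (hc : IsCycleWord (insert a B) c)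
    (hσ : IsLabelledDerangement (A \ B) σ) : IsLabelledDerangement (insert a A) (c :: σ) := by
  have haA : a ∉ A := fun h => lt_irrefl _ (ha a h)
  refine ⟨?_, ?_, ?_⟩
  · rw [List.flatten_cons, ← Multiset.coe_add, hc.entries, hσ.entries, ← nsmul_add,
      insert_val_add_sdiff_val haA hB]
  · intro c' hc'
    rcases List.mem_cons.1 hc' with rfl | hc'
    · rw [hc.toFinset_eq]
      refine ⟨hc, ?_⟩
      rw [Finset.card_insert_of_notMem fun h => haA (hB h)]
      have := Finset.card_pos.2 hne
      omega
    · exact hσ.cycle c' hc'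
  · refine List.pairwise_cons.2 ⟨fun c' hc' => ?_, hσ.increasing⟩
    have h1 : c.headI ≤ a := hc.head_le a (hc.mem_iff.2 (by simp))
    have h2 : c'.headI ∈ A \ B := hσ.mem_label hc' (headI_mem (hσ.cycle_ne_nil hc'))
    exact h1.trans_lt (ha _ (Finset.mem_sdiff.1 h2).1)

/-- The cycle of the smallest letter a must be listed first: if a lay in a later cycle, the head of
that cycle would be at most a and yet larger than the first head, which is at least a. -/
theorem exists_cons_of_isLabelledDerangement {a : ℕ} {A : Finset ℕ} (ha : ∀ b ∈ A, a < b)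
    {σ : List (List ℕ)} (h : IsLabelledDerangement (insert a A) σ) :
    ∃ B c σ', B ⊆ A ∧ B.Nonempty ∧ IsCycleWord (insert a B) c ∧
      IsLabelledDerangement (A \ B) σ' ∧ σ = c :: σ' := by
  have haA : a ∉ A := fun h => lt_irrefl _ (ha a h)
  have haσ : a ∈ σ.flatten := by
    rw [← Multiset.mem_coe, h.entries, Multiset.mem_nsmul_of_ne_zero two_ne_zero]
    simp
  rcases σ with _ | ⟨c, σ⟩
  · simp at haσ
  have hcσ : c ∈ c :: σ := by simp
  obtain ⟨hw, hcard⟩ := h.cycle c hcσ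
  obtain ⟨hhead, hinc⟩ := List.pairwise_cons.1 h.increasing
  have hac : a ∈ c := by
    rw [List.flatten_cons, List.mem_append] at haσ
    refine haσ.resolve_right fun hσ => ?_
    obtain ⟨c', hc', hac'⟩ := List.mem_flatten.1 hσ
    have h1 := hhead c' hc'
    have h2 := (h.cycle c' (by simp [hc'])).1.head_le a hac'
    rcases Finset.mem_insert.1 (h.mem_label hcσ (headI_mem (h.cycle_ne_nil hcσ))) with h3 | h3
    · omega
    · have := ha _ h3
      omega
  have hins : insert a (c.toFinset.erase a) = c.toFinset :=
    Finset.insert_erase (List.mem_toFinset.2 hac)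
  have hsub : c.toFinset.erase a ⊆ A := by
    intro x hx
    rw [Finset.mem_erase, List.mem_toFinset] at hx
    exact (Finset.mem_insert.1 (h.mem_label hcσ hx.2)).resolve_left hx.1
  refine ⟨c.toFinset.erase a, c, σ, hsub, ?_, by rwa [hins], ⟨?_, ?_, hinc⟩, rfl⟩
  · rw [← Finset.card_pos, Finset.card_erase_of_mem (List.mem_toFinset.2 hac)]
    omega
  · have h1 := h.entries
    rw [List.flatten_cons, ← Multiset.coe_add, ← insert_val_add_sdiff_val haA hsub, hins,
      nsmul_add, hw.entries] at h1
    exact add_left_cancel h1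
  · exact fun c' hc' => h.cycle c' (by simp [hc'])

/-- B is the set of companions of a in its cycle, so that cycle has |B| + 1 distinct letters; B = ∅
would make a a fixed point and contributes 0. -/
theorem sum_labelledDerangements_insert {a : ℕ} {A : Finset ℕ} (ha : ∀ b ∈ A, a < b) :
    ∑ σ ∈ labelledDerangements (insert a A), (X : ℚ[X]) ^ cap σ =
      ∑ B ∈ A.powerset, (if B.card = 0 then 0 else cyclePoly B.card) *
        ∑ σ ∈ labelledDerangements (A \ B), X ^ cap σ := by
  have haA : a ∉ A := fun h => lt_irrefl _ (ha a h)
  have h1 : ∀ B ∈ A.powerset, (if B.card = 0 then 0 else cyclePoly B.card) *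
        ∑ σ ∈ labelledDerangements (A \ B), X ^ cap σ =
      ∑ p ∈ (if B.card = 0 then ∅ else cycleWords (insert a B)) ×ˢ labelledDerangements (A \ B),
        (X : ℚ[X]) ^ cap (p.1 :: p.2) := by
    intro B hB
    split_ifs with h
    · simp
    · rw [← sum_cycleWords B.card (insert a B)
        (Finset.card_insert_of_notMem fun h => haA (Finset.mem_powerset.1 hB h)),
        Finset.sum_mul_sum, Finset.sum_product]
      refine Finset.sum_congr rfl fun c _ => Finset.sum_congr rfl fun σ _ => ?_
      simp [cap, pow_add]
  rw [Finset.sum_congr rfl h1, Finset.sum_sigma']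
  symm
  have hmem : ∀ p : (_ : Finset ℕ) × (List ℕ × List (List ℕ)),
      p ∈ A.powerset.sigma (fun B => (if B.card = 0 then ∅ else cycleWords (insert a B)) ×ˢ
        labelledDerangements (A \ B)) ↔ p.1 ⊆ A ∧ p.1.Nonempty ∧ IsCycleWord (insert a p.1) p.2.1 ∧
          IsLabelledDerangement (A \ p.1) p.2.2 := by
    rintro ⟨B, c, σ⟩
    simp only [Finset.mem_sigma, Finset.mem_powerset, Finset.mem_product, mem_labelledDerangements]
    split_ifs with h
    · simp [Finset.card_eq_zero.1 h]
    · simp [mem_cycleWords, Finset.nonempty_iff_ne_empty, Finset.card_eq_zero.not.1 h]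
  refine Finset.sum_nbij (fun p => p.2.1 :: p.2.2) ?_ ?_ ?_ fun _ _ => rfl
  · intro p hp
    obtain ⟨hB, hne, hc, hσ⟩ := (hmem p).1 hp
    exact mem_labelledDerangements.2 (isLabelledDerangement_cons ha hB hne hc hσ)
  · rintro ⟨B, c, σ⟩ hp ⟨B', c', σ'⟩ hp' h
    obtain ⟨hB, -, hc, -⟩ := (hmem _).1 hp
    obtain ⟨hB', -, hc', -⟩ := (hmem _).1 hp'
    simp only [List.cons.injEq] at h
    obtain ⟨rfl, rfl⟩ := h
    have h2 : insert a B = insert a B' := hc.toFinset_eq.symm.trans hc'.toFinset_eq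
    have h3 := congrArg (Finset.erase · a) h2
    simp only [Finset.erase_insert fun h => haA (hB h),
      Finset.erase_insert fun h => haA (hB' h)] at h3
    rw [h3]
  · intro σ hσ
    obtain ⟨B, c, σ', hB, hne, hc, hσ', rfl⟩ :=
      exists_cons_of_isLabelledDerangement ha (mem_labelledDerangements.1 hσ)
    exact ⟨⟨B, c, σ'⟩, (hmem _).2 ⟨hB, hne, hc, hσ'⟩, rfl⟩

theorem sum_labelledDerangements_succ {r : ℕ → ℚ[X]} {n : ℕ}
    (hr : ∀ k ≤ n, ∀ A : Finset ℕ, A.card = k →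
      ∑ σ ∈ labelledDerangements A, (X : ℚ[X]) ^ cap σ = r k)
    {A : Finset ℕ} (hA : A.card = n + 1) :
    ∑ σ ∈ labelledDerangements A, (X : ℚ[X]) ^ cap σ =
      ∑ k ∈ Finset.range (n + 1),
        (n.choose k : ℚ[X]) * (if k = 0 then 0 else cyclePoly k) * r (n - k) := by
  have hne : A.Nonempty := Finset.card_pos.1 (by omega)
  have hmin := A.min'_mem hne
  have hc : (A.erase (A.min' hne)).card = n := by
    rw [Finset.card_erase_of_mem hmin, hA, Nat.add_sub_cancel]
  rw [← Finset.insert_erase hmin, sum_labelledDerangements_insert fun b hb =>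
    Finset.min'_lt_of_mem_erase_min' A hne hb]
  have h1 : ∀ B ∈ (A.erase (A.min' hne)).powerset,
      (if B.card = 0 then 0 else cyclePoly B.card) *
        ∑ σ ∈ labelledDerangements (A.erase (A.min' hne) \ B), (X : ℚ[X]) ^ cap σ =
      (fun k => (if k = 0 then 0 else cyclePoly k) * r (n - k)) B.card := by
    intro B hB
    have hB := Finset.card_sdiff_of_subset (Finset.mem_powerset.1 hB)
    rw [hc] at hB
    rw [hr (n - B.card) (by omega) _ hB]
  rw [Finset.sum_congr rfl h1, Finset.sum_powerset_apply_card
    (fun k => (if k = 0 then 0 else cyclePoly k) * r (n - k)), hc]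
  refine Finset.sum_congr rfl fun k _ => ?_
  rw [nsmul_eq_mul, mul_assoc]

theorem R_eq_sum (n : ℕ) :
    R n = ∑ σ ∈ labelledDerangements (Finset.Icc 1 n), X ^ cap σ := by
  rw [R, stirlingDerangements_eq]

theorem R_zero : R 0 = 1 := by
  have : labelledDerangements (Finset.Icc 1 0) = {[]} := by
    ext σ
    rw [mem_labelledDerangements, Finset.mem_singleton]
    constructor
    · intro h
      rcases σ with _ | ⟨c, σ⟩
      · rfl
      · have hc : c ∈ c :: σ := by simp
        simpa using h.mem_label hc (headI_mem (h.cycle_ne_nil hc))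
    · rintro rfl
      exact ⟨rfl, by simp, List.Pairwise.nil⟩
  rw [R_eq_sum, this]
  simp [cap]

/-- Independence of the labels is obtained without a relabelling bijection: the recursion for A and
the one for {1, …, n} have the same right-hand side. -/
theorem sum_labelledDerangements (n : ℕ) (A : Finset ℕ) (hA : A.card = n) :
    ∑ σ ∈ labelledDerangements A, (X : ℚ[X]) ^ cap σ = R n := by
  induction n using Nat.strong_induction_on generalizing A with
  | _ n ih =>
    rcases n with _ | n
    · rw [Finset.card_eq_zero.1 hA, R_eq_sum]
      simp
    · have hr : ∀ k ≤ n, ∀ A : Finset ℕ, A.card = k →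
          ∑ σ ∈ labelledDerangements A, (X : ℚ[X]) ^ cap σ = R k :=
        fun k hk => ih k (by omega)
      rw [R_eq_sum, sum_labelledDerangements_succ hr hA,
        sum_labelledDerangements_succ (A := Finset.Icc 1 (n + 1)) hr (by simp)]

theorem R_succ (n : ℕ) : R (n + 1) = ∑ k ∈ Finset.range (n + 1),
    (n.choose k : ℚ[X]) * (if k = 0 then 0 else cyclePoly k) * R (n - k) := by
  rw [R_eq_sum, sum_labelledDerangements_succ (n := n) (fun k _ => sum_labelledDerangements k) (by simp)]

theorem sq_egf_R : egf R ^ 2 = PowerSeries.rescale 2 (egf d) := by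
  refine mul_right_cancel₀ denom_ne_zero ?_
  rw [sq_egf_mul_denom R_zero R_succ, d_eq_derPoly, egf_derPoly_mul_denom]

end StirlingSecond

end

theorem mainTheorem11 :
    PowerSeries.map (algebraMap (Polynomial ℚ) (RatFunc ℚ)) (StirlingSecond.egf StirlingSecond.R) =
      StirlingSecond.formalSqrt StirlingSecond.closedForm ∧
    (StirlingSecond.egf StirlingSecond.R) ^ 2 =
      PowerSeries.rescale 2 (StirlingSecond.egf StirlingSecond.d) ∧
    ∀ n : ℕ, 2 ^ n * StirlingSecond.d n =
      ∑ k ∈ Finset.range (n + 1),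
        (n.choose k : Polynomial ℚ) * StirlingSecond.R k * StirlingSecond.R (n - k) := by
  open StirlingSecond in
  refine ⟨eq_formalSqrt ?_ ?_, sq_egf_R, fun n => ?_⟩
  · rw [← PowerSeries.coeff_zero_eq_constantCoeff_apply, PowerSeries.coeff_map, coeff_egf, R_zero]
    simp
  · rw [← map_pow]
    exact map_eq_closedForm (sq_egf_mul_denom R_zero R_succ)
  · have h := sq_egf_R
    rw [sq, egf_mul, rescale_egf] at h
    have hn := congrArg (PowerSeries.coeff n) h
    rw [coeff_egf, coeff_egf] at hn
    refine (mul_left_cancel₀ ?_ hn).symm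
    rw [Ne, Polynomial.C_eq_zero, inv_eq_zero]
    exact_mod_cast n.factorial_ne_zero
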